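/- Let $n\ge 1$ and $m\ge 0$ be integers. For $r\ge 0$ let $S^r$ be the space of symmetric complex tensors $u=(u_{i_1\dots i_r})$, $1\le i_1,\dots,i_r\le n$, of rank $r$ on $\mathbb R^n$ (components in the standard orthonormal basis; repeated indices are summed). For $u\in S^r$ let $i_u:S^k\to S^{k+r}$ be symmetric multiplication by $u$, $i_uv=\sigma(u\otimes v)$, where $\sigma$ is the symmetrization in all indices (the average over all permutations of the indices), and let $j_u:S^{k+r}\to S^k$ be the contraction $$(j_uv)_{i_1\dots i_k}=v_{i_1\dots i_kl_1\dots l_r}\,u^{l_1\dots l_r}=:(v/u)_{i_1\dots i_k}.$$ Write $i=i_\delta$ for the Kronecker tensor $\delta$, and $i_y,j_y$ for the operators given by a vector $y\in\mathbb R^n=\{\text{real vectors in } S^1\}$. For $0\le k\le m$ define the symmetric tensor field $A^{(m,k)}$ of rank $2m-k$ on $\mathbb R^n\setminus\{0\}$ by $$A^{(m,k)}_{i_1\dots i_{2m-k}}(y)=\frac{\partial^{2m-k}}{\partial y^{i_1}\cdots\partial y^{i_{2m-k}}}\,|y|^{2m-2k-1}.$$ Let $H^{(m,k)}:\mathbb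 R^n\setminus\{0\}\to S^{m-k}$ $(0\le k\le m)$ be given tensor fields. If the system $$A^{(m,k)}(y)/g(y)=H^{(m,k)}(y)\qquad(0\le k\le m,\ y\in\mathbb R^n\setminus\{0\})$$ has a solution $g:\mathbb R^n\setminus\{0\}\to S^m$, then the solution is unique and is expressed by $$g(y)=\frac{|y|}{m!}\sum_{k=0}^m\frac{(-1)^k}{(2m-2k-1)!!}\binom mk\sum_{p=0}^{\min(k,m-k)}\frac{(-1)^p}{2^p}\binom{m-k}{p}\,i^{p}\,i_y^{k-p}\,j_y^{p}\,H^{(m,k)}(y)\qquad(y\ne 0),$$ where $(2l-1)!!=1\cdot3\cdots(2l-1)$ for $l\ge1$ and $(-1)!!=1$. -/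

import Mathlib

/-- `T^m ℝⁿ`: complex `m`-tensors on `ℝⁿ`, given by their components `u_{i₁…i_m}` in the standard
orthonormal basis. -/
abbrev Tensor (n m : ℕ) : Type := (Fin m → Fin n) → ℂ

namespace Tensor

variable {n : ℕ}

/-- Transport along an equality of ranks. -/
def cast {a b : ℕ} (h : a = b) (u : Tensor n a) : Tensor n b :=
  fun i => u (i ∘ Fin.cast h)

/-- Symmetrization `σ` in all indices. -/
noncomputable def symmetrize {m : ℕ} (u : Tensor n m) : Tensor n m :=
  fun i => (m.factorial : ℂ)⁻¹ * ∑ π : Equiv.Perm (Fin m), u (i ∘ π)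

/-- `S^m ℝⁿ`: the subspace of symmetric tensors. -/
def symm (n m : ℕ) : Submodule ℂ (Tensor n m) where
  carrier := {u | ∀ (π : Equiv.Perm (Fin m)) (i : Fin m → Fin n), u (i ∘ π) = u i}
  add_mem' := fun hu hv π i => by simp only [Pi.add_apply, hu π i, hv π i]
  zero_mem' := fun _ _ => rfl
  smul_mem' := fun c u hu π i => by simp only [Pi.smul_apply, hu π i]

/-- The tensor product `v ⊗ u`. -/
def tmul {k r : ℕ} (v : Tensor n k) (u : Tensor n r) : Tensor n (k + r) :=
  fun i => v (i ∘ Fin.castAdd r) * u (i ∘ Fin.natAdd k)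

/-- `i_u`, symmetric multiplication by `u`. The factor `u` is placed in the last `r` slots, which is
immaterial because of the symmetrization. -/
noncomputable def iMul {k r : ℕ} (u : Tensor n r) (v : Tensor n k) : Tensor n (k + r) :=
  symmetrize (tmul v u)

/-- `j_u v = v / u`, the contraction (without complex conjugation) of the last `r` indices of `v`
with `u`: `(v / u)_{i₁…i_k} = v_{i₁…i_k l₁…l_r} u^{l₁…l_r}`. -/
def jContr {k r : ℕ} (u : Tensor n r) (v : Tensor n (k + r)) : Tensor n k :=
  fun i => ∑ l : Fin r → Fin n, v (Fin.append i l) * u l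

/-- The power `i_u^p`. -/
noncomputable def iMulPow {r : ℕ} (u : Tensor n r) :
    (p : ℕ) → {k : ℕ} → Tensor n k → Tensor n (k + r * p)
  | 0, _, v => v
  | p + 1, _, v => cast (by rw [Nat.mul_succ, Nat.add_assoc]) (iMul u (iMulPow u p v))

/-- The power `j_u^p`. -/
def jContrPow {r : ℕ} (u : Tensor n r) :
    (p : ℕ) → {k : ℕ} → Tensor n (k + r * p) → Tensor n k
  | 0, _, v => v
  | p + 1, _, v => jContrPow u p (jContr u (cast (by rw [Nat.mul_succ, Nat.add_assoc]) v))

/-- A vector `y ∈ ℝⁿ` as a tensor of rank one. -/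
def ofVec (y : EuclideanSpace ℝ (Fin n)) : Tensor n 1 := fun i => (y (i 0) : ℂ)

/-- The Kronecker tensor `δ`. -/
def kronecker (n : ℕ) : Tensor n 2 := fun i => if i 0 = i 1 then 1 else 0

end Tensor

/-- `ℝⁿ ∖ {0}`. -/
abbrev PuncturedSpace (n : ℕ) : Type := {y : EuclideanSpace ℝ (Fin n) // y ≠ 0}

/-- The tensor field `A^{(m,k)} = d^{2m-k} |y|^{2m-2k-1}`, i.e.
`A^{(m,k)}_{i₁…i_{2m-k}} = ∂_{i₁…i_{2m-k}} |y|^{2m-2k-1}`. It is used only at points `y ≠ 0`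
and for `k ≤ m`. -/
noncomputable def fieldA (n m k : ℕ) (y : EuclideanSpace ℝ (Fin n)) : Tensor n (2 * m - k) :=
  fun i => ((iteratedFDeriv ℝ (2 * m - k)
    (fun x : EuclideanSpace ℝ (Fin n) => ‖x‖ ^ (2 * (m : ℤ) - 2 * (k : ℤ) - 1)) y
    (fun a => EuclideanSpace.single (i a) (1 : ℝ)) : ℝ) : ℂ)

/-- The symmetric `m`-tensor field `g` on `ℝⁿ ∖ {0}` solves the system
`A^{(m,k)} / g = H^{(m,k)}`, `0 ≤ k ≤ m`. -/
def IsSystemSolution {n m : ℕ}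
    (H : (k : Fin (m + 1)) → PuncturedSpace n → Tensor.symm n (m - k))
    (g : PuncturedSpace n → Tensor.symm n m) : Prop :=
  ∀ (k : Fin (m + 1)) (y : PuncturedSpace n),
    Tensor.jContr (g y : Tensor n m)
      (Tensor.cast (by omega : 2 * m - (k : ℕ) = (m - k) + m) (fieldA n m k y)) =
    (H k y : Tensor n (m - k))

/-!
Contracting with `x ⊗ ⋯ ⊗ x`, `x ∈ ℝⁿ`, determines a symmetric tensor, so it is enough to recover
the polynomial `⟨g, x ⊗ ⋯ ⊗ x⟩`. Put `d = ⟨x, y⟩` and `e = d s + |x|² s² / 2`. Since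
`|z + s x|² - 2 e = |z|² + 2 (⟨x, z⟩ - d) s` is affine in `s`, the `m`-th derivative at `s = 0` of
its power `m - 1/2` is a multiple of `(⟨x, z⟩ - d)ᵐ |z|⁻¹`. Expanding the same power in powers of
`e`, which vanishes at `s = 0`, writes this derivative as a combination of the derivatives
`D^{m-k-p} |z|^{2m-2k-1} (x, …, x)`. Apply `Dᵐ` at `z = y`: on one side only `m` differentiations
of `(⟨x, z⟩ - d)ᵐ` survive, which gives the contraction with `x ⊗ ⋯ ⊗ x`; on the other side the
tensors `A^{(m,k)}(y)` appear. By Euler's identity for homogeneous functions, the coefficients of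
the combination can be absorbed into `p` further contractions with `y`.
-/

open Filter Topology Finset
open scoped ContDiff

section IteratedDerivatives

variable {𝕜 E F : Type*} [NontriviallyNormedField 𝕜] [NormedAddCommGroup E] [NormedSpace 𝕜 E]
  [NormedAddCommGroup F] [NormedSpace 𝕜 F] {φ : E → F} {z : E}

lemma contDiffAt_iteratedFDeriv_apply_const (h : ContDiffAt 𝕜 ω φ z) {N : ℕ} (v : Fin N → E) :
    ContDiffAt 𝕜 ω (fun z => iteratedFDeriv 𝕜 N φ z v) z :=
  (ContinuousMultilinearMap.apply 𝕜 (fun _ : Fin N => E) F v).contDiff.contDiffAt.comp z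
    (h.iteratedFDeriv_right (m := ω) (by simp))

lemma iteratedFDeriv_cons_apply (h : ContDiffAt 𝕜 ω φ z) {N : ℕ} (w : E) (v : Fin N → E) :
    iteratedFDeriv 𝕜 (N + 1) φ z (Fin.cons w v) =
      fderiv 𝕜 (fun z => iteratedFDeriv 𝕜 N φ z v) z w := by
  rw [(h.differentiableAt_iteratedFDeriv (by simp)).iteratedFDeriv_succ_apply_left',
    Fin.cons_zero, Fin.tail_cons]

lemma iteratedFDeriv_comp_finEquiv (h : ContDiffAt 𝕜 ω φ z) {M N : ℕ} (σ : Fin M ≃ Fin N)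
    (v : Fin N → E) : iteratedFDeriv 𝕜 M φ z (v ∘ σ) = iteratedFDeriv 𝕜 N φ z v := by
  obtain rfl : M = N := by simpa using Fintype.card_congr σ
  exact h.iteratedFDeriv_comp_perm v σ

lemma iteratedFDeriv_append (h : ContDiffAt 𝕜 ω φ z) {a b : ℕ} (u : Fin a → E) (v : Fin b → E) :
    iteratedFDeriv 𝕜 (a + b) φ z (Fin.append u v) =
      iteratedFDeriv 𝕜 a (fun z => iteratedFDeriv 𝕜 b φ z v) z u := by
  induction a generalizing z with
  | zero =>
    rw [iteratedFDeriv_zero_apply, Subsingleton.elim u Fin.elim0, Fin.elim0_append]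
    exact iteratedFDeriv_comp_finEquiv h (finCongr (Nat.zero_add b)) v
  | succ a ih =>
    have hev : (fun z => iteratedFDeriv 𝕜 (a + b) φ z (Fin.append (Fin.tail u) v)) =ᶠ[𝓝 z]
        fun z => iteratedFDeriv 𝕜 a (fun z => iteratedFDeriv 𝕜 b φ z v) z (Fin.tail u) := by
      filter_upwards [h.eventually (by simp)] with t ht using ih ht _
    have hu : Fin.append u v =
        (Fin.cons (u 0) (Fin.append (Fin.tail u) v) : Fin (a + b + 1) → E) ∘
          finCongr (Nat.succ_add a b) := by
      conv_lhs => rw [← Fin.cons_self_tail u]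
      exact Fin.append_cons _ _ _
    rw [hu, iteratedFDeriv_comp_finEquiv h, iteratedFDeriv_cons_apply h, hev.fderiv_eq,
      ← iteratedFDeriv_cons_apply (contDiffAt_iteratedFDeriv_apply_const h v),
      Fin.cons_self_tail]

lemma iteratedFDeriv_iteratedFDeriv_comm (h : ContDiffAt 𝕜 ω φ z) {a b : ℕ} (u : Fin a → E)
    (v : Fin b → E) :
    iteratedFDeriv 𝕜 a (fun z => iteratedFDeriv 𝕜 b φ z v) z u =
      iteratedFDeriv 𝕜 b (fun z => iteratedFDeriv 𝕜 a φ z u) z v := by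
  have hflip : Fin.append v u ∘ finAddFlip = Fin.append u v := by
    ext1 i
    refine Fin.addCases (fun i => ?_) (fun i => ?_) i <;> simp
  rw [← iteratedFDeriv_append h, ← iteratedFDeriv_append h, ← hflip,
    iteratedFDeriv_comp_finEquiv h]

lemma iteratedFDeriv_comp_smul_apply {c : 𝕜} (hc : c ≠ 0) (φ : E → F) (z : E) {N : ℕ}
    (v : Fin N → E) :
    iteratedFDeriv 𝕜 N (fun z => φ (c • z)) z v = c ^ N • iteratedFDeriv 𝕜 N φ (c • z) v := by
  have hcomp := (ContinuousLinearEquiv.smulLeft (R₁ := 𝕜) (M₁ := E)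
    (Units.mk0 c hc)).iteratedFDerivWithin_comp_right φ uniqueDiffOn_univ
    (Set.mem_univ (c • z)) N
  rw [Set.preimage_univ, iteratedFDerivWithin_univ, iteratedFDerivWithin_univ] at hcomp
  have hmul := (iteratedFDeriv 𝕜 N φ (c • z)).map_smul_univ (fun _ => c) v
  rw [prod_const, card_univ, Fintype.card_fin] at hmul
  exact (DFunLike.congr_fun hcomp v).trans hmul

lemma iteratedDeriv_comp_add_smul {x : E} {s : 𝕜} (h : ContDiffAt 𝕜 ω φ (z + s • x)) (N : ℕ) :
    iteratedDeriv N (fun s => φ (z + s • x)) s =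
      iteratedFDeriv 𝕜 N φ (z + s • x) (fun _ => x) := by
  induction N generalizing s with
  | zero => simp
  | succ N ih =>
    have hline : ContinuousAt (fun s : 𝕜 => z + s • x) s := by fun_prop
    have hev : iteratedDeriv N (fun s => φ (z + s • x)) =ᶠ[𝓝 s]
        fun s => iteratedFDeriv 𝕜 N φ (z + s • x) (fun _ => x) := by
      filter_upwards [hline.eventually (h.eventually (by simp))] with t ht using ih ht
    rw [iteratedDeriv_succ, hev.deriv_eq, (h.of_le le_top).deriv_fderiv_add_smul]

end IteratedDerivatives

section AffinePower

variable {E : Type*} [NormedAddCommGroup E] [NormedSpace ℝ E]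

lemma iteratedFDeriv_affine_pow_mul (ℓ : E →L[ℝ] ℝ) {y : E} {h : E → ℝ} (hh : ContDiffAt ℝ ω h y)
    {m : ℕ} (w : Fin m → E) :
    iteratedFDeriv ℝ m (fun z => (ℓ z - ℓ y) ^ m * h z) y w =
      m.factorial * (∏ i, ℓ (w i)) * h y := by
  induction m generalizing h with
  | zero => simp
  | succ m ih =>
    set a := w (Fin.last m)
    have hF : ContDiffAt ℝ ω (fun z => (ℓ z - ℓ y) ^ (m + 1) * h z) y := by fun_prop
    have : ContDiffAt ℝ ω (fderiv ℝ h) y := hh.fderiv_right (by simp)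
    have hderiv : (fun z => iteratedFDeriv ℝ 1 (fun z => (ℓ z - ℓ y) ^ (m + 1) * h z) z
          (fun _ => a)) =ᶠ[𝓝 y]
        fun z => (ℓ z - ℓ y) ^ m * ((m + 1) * ℓ a * h z + (ℓ z - ℓ y) * fderiv ℝ h z a) := by
      filter_upwards [hh.eventually (by simp)] with z hz
      have hprod : HasFDerivAt (fun z => (ℓ z - ℓ y) ^ (m + 1) * h z) _ z :=
        ((ℓ.hasFDerivAt.sub_const (ℓ y)).pow (m + 1)).mul
          (hz.differentiableAt (by simp)).hasFDerivAt
      rw [iteratedFDeriv_one_apply, hprod.fderiv]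
      simp only [add_tsub_cancel_right, nsmul_eq_mul, Nat.cast_add, Nat.cast_one, add_apply,
        smul_apply, smul_eq_mul]
      ring
    have hw : w = Fin.append (Fin.init w) (fun _ : Fin 1 => a) := by
      rw [Fin.append_right_eq_snoc, Fin.snoc_init_self]
    calc iteratedFDeriv ℝ (m + 1) (fun z => (ℓ z - ℓ y) ^ (m + 1) * h z) y w
        = iteratedFDeriv ℝ m (fun z => (ℓ z - ℓ y) ^ m *
            ((m + 1) * ℓ a * h z + (ℓ z - ℓ y) * fderiv ℝ h z a)) y (Fin.init w) := by
          rw [hw, iteratedFDeriv_append hF, (hderiv.iteratedFDeriv ℝ m).self_of_nhds, ← hw]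
      _ = m.factorial * (∏ i, ℓ (Fin.init w i)) * ((m + 1) * ℓ a * h y) := by
          rw [ih (by fun_prop), sub_self, zero_mul, add_zero]
      _ = (m + 1).factorial * (∏ i, ℓ (w i)) * h y := by
          rw [Fin.prod_univ_castSucc, Nat.factorial_succ]
          push_cast [Fin.init]
          ring

end AffinePower

section Homogeneous

variable {E : Type*} [NormedAddCommGroup E] [NormedSpace ℝ E]

/-- Positive homogeneity of integral degree `d`. -/
def IsPosHomogeneous (d : ℤ) (φ : E → ℝ) : Prop :=
  ∀ ⦃c : ℝ⦄, 0 < c → ∀ z, φ (c • z) = c ^ d * φ z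

namespace IsPosHomogeneous

lemma norm_zpow (j : ℤ) : IsPosHomogeneous j fun z : E => ‖z‖ ^ j := by
  intro c hc z
  simp only [norm_smul, mul_zpow, Real.norm_of_nonneg hc.le]

lemma iteratedFDeriv_apply {d : ℤ} {φ : E → ℝ} (h : IsPosHomogeneous d φ) {N : ℕ}
    (v : Fin N → E) : IsPosHomogeneous (d - N) fun z => iteratedFDeriv ℝ N φ z v := by
  intro c hc z
  have hscale : (fun z => φ (c • z)) = fun z => c ^ d • φ z := funext (h hc)
  have hleft : iteratedFDeriv ℝ N (fun z => φ (c • z)) z v =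
      c ^ N * iteratedFDeriv ℝ N φ (c • z) v := iteratedFDeriv_comp_smul_apply hc.ne' φ z v
  have hright : iteratedFDeriv ℝ N (fun z => c ^ d • φ z) z v =
      c ^ d * iteratedFDeriv ℝ N φ z v := by
    exact DFunLike.congr_fun ((ContinuousLinearEquiv.smulLeft (R₁ := ℝ) (M₁ := ℝ)
      (Units.mk0 (c ^ d) (zpow_ne_zero d hc.ne'))).iteratedFDeriv_comp_left (f := φ) (x := z)
        (i := N)) v
  have hc' : c ^ N ≠ 0 := pow_ne_zero _ hc.ne'
  rw [zpow_sub₀ hc.ne', zpow_natCast, div_mul_eq_mul_div, eq_div_iff hc', mul_comm, ← hleft,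
    hscale, hright]

lemma iteratedFDeriv_self {d : ℤ} {φ : E → ℝ} (h : IsPosHomogeneous d φ) {y : E}
    (hφ : ContDiffAt ℝ ω φ y) (p : ℕ) :
    iteratedFDeriv ℝ p φ y (fun _ => y) = (∏ i ∈ range p, ((d : ℝ) - i)) * φ y := by
  have hline : (fun s : ℝ => φ (y + s • y)) =ᶠ[𝓝 0] fun s => (1 + s) ^ d * φ y := by
    filter_upwards [lt_mem_nhds (show (-1 : ℝ) < 0 by norm_num)] with s hs
    rw [← h (by linarith), add_smul, one_smul]
  calc iteratedFDeriv ℝ p φ y (fun _ => y)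
      = iteratedDeriv p (fun s : ℝ => φ (y + s • y)) 0 := by
        rw [iteratedDeriv_comp_add_smul (by simpa using hφ), zero_smul, add_zero]
    _ = iteratedDeriv p (fun s : ℝ => (1 + s) ^ d) 0 * φ y := by
        rw [hline.iteratedDeriv_eq, iteratedDeriv_mul_const_field]
    _ = (∏ i ∈ range p, ((d : ℝ) - i)) * φ y := by
        simp only [iteratedDeriv_comp_const_add p (fun s : ℝ => s ^ d), iteratedDeriv_eq_iterate,
          iter_deriv_zpow, add_zero, one_zpow, mul_one]

end IsPosHomogeneous

end Homogeneous

section PowMul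

variable {𝕜 : Type*} [NontriviallyNormedField 𝕜] {f : 𝕜 → 𝕜}

lemma contDiffAt_zpow {E : Type*} [NormedAddCommGroup E] [NormedSpace 𝕜 E] {φ : E → 𝕜} {z : E}
    (h : ContDiffAt 𝕜 ω φ z) (h0 : φ z ≠ 0) (j : ℤ) : ContDiffAt 𝕜 ω (fun z => φ z ^ j) z := by
  cases j with
  | ofNat j => simpa using h.pow j
  | negSucc j =>
    simp only [zpow_negSucc]
    exact (h.pow (j + 1)).inv (pow_ne_zero _ h0)

lemma iteratedDeriv_pow_mul_zero {m : ℕ} (hf : ContDiffAt 𝕜 m f 0) (j : ℕ) :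
    iteratedDeriv m (fun s => s ^ j * f s) 0 =
      m.descFactorial j * iteratedDeriv (m - j) f 0 := by
  rw [iteratedDeriv_fun_mul (by fun_prop) hf]
  simp only [iteratedDeriv_fun_pow_zero, Nat.cast_ite, Nat.cast_zero, mul_ite, ite_mul, mul_zero,
    zero_mul, sum_ite_eq', mem_range, Nat.lt_succ_iff]
  split_ifs with hj
  · rw [Nat.descFactorial_eq_factorial_mul_choose, Nat.cast_mul, mul_comm (m.choose j : 𝕜)]
  · rw [Nat.descFactorial_eq_zero_iff_lt.2 (not_le.1 hj), Nat.cast_zero, zero_mul]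

end PowMul

section HalfIntegerPowers

/-- The coefficient of `e ^ k * ν ^ (2 * m - 2 * k - 1)` in the expansion of
`(ν ^ 2 - 2 * e) ^ (m - 1 / 2) / (2 * m - 1)‼` in powers of `e`. -/
noncomputable def halfPowCoeff (m k : ℕ) : ℝ :=
  (-1) ^ k / (k.factorial * (Nat.doubleFactorial (2 * (m - k) - 1) : ℝ))

lemma halfPowCoeff_succ_mul {m k : ℕ} (hk : k ≤ m) :
    halfPowCoeff (m + 1) k * ((2 * (m + 1 : ℕ) - 2 * k - 1 : ℤ) : ℝ) = halfPowCoeff m k := by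
  obtain ⟨j, rfl⟩ := Nat.exists_eq_add_of_le hk
  have hj : ((2 * j - 1).doubleFactorial : ℝ) ≠ 0 := mod_cast (Nat.doubleFactorial_pos _).ne'
  have hj' : (2 * j + 1 : ℝ) ≠ 0 := by positivity
  rw [halfPowCoeff, halfPowCoeff, show 2 * (k + j + 1 - k) - 1 = 2 * j + 1 by omega,
    Nat.add_sub_cancel_left, Nat.doubleFactorial_add_one]
  push_cast
  field_simp
  ring

lemma halfPowCoeff_succ_succ_mul (m k : ℕ) :
    halfPowCoeff (m + 1) (k + 1) * (k + 1) = -halfPowCoeff m k := by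
  have hk : ((2 * (m - k) - 1).doubleFactorial : ℝ) ≠ 0 := mod_cast (Nat.doubleFactorial_pos _).ne'
  rw [halfPowCoeff, halfPowCoeff, Nat.factorial_succ, Nat.add_sub_add_right]
  push_cast
  field_simp
  ring

/-- The expansion of `(ν ^ 2 - 2 * e) ^ (m - 1 / 2) / (2 * m - 1)‼` in powers of `e`, truncated
after the power `e ^ m`. -/
noncomputable def halfPowSum (m : ℕ) (e ν : ℝ) : ℝ :=
  ∑ k ∈ range (m + 1), halfPowCoeff m k * (e ^ k * ν ^ (2 * (m : ℤ) - 2 * (k : ℤ) - 1))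

lemma sum_halfPowCoeff_succ_mul_left (m : ℕ) (e ν : ℝ) :
    ∑ k ∈ range (m + 2), halfPowCoeff (m + 1) k *
      (k * e ^ (k - 1) * ν ^ (2 * ((m + 1 : ℕ) : ℤ) - 2 * (k : ℤ) - 1)) = -halfPowSum m e ν := by
  rw [sum_range_succ', halfPowSum, ← sum_neg_distrib, Nat.cast_zero, zero_mul, zero_mul, mul_zero,
    add_zero]
  refine sum_congr rfl fun k _ => ?_
  rw [Nat.add_sub_cancel, ← neg_mul, ← halfPowCoeff_succ_succ_mul,
    show 2 * ((m + 1 : ℕ) : ℤ) - 2 * ((k + 1 : ℕ) : ℤ) - 1 = 2 * (m : ℤ) - 2 * k - 1 by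
      push_cast; ring]
  push_cast
  ring

lemma sum_halfPowCoeff_succ_mul_right (m : ℕ) (e ν : ℝ) :
    ∑ k ∈ range (m + 2), halfPowCoeff (m + 1) k * (((2 * (m + 1 : ℕ) - 2 * k - 1 : ℤ) : ℝ) *
      (e ^ k * ν ^ (2 * ((m + 1 : ℕ) : ℤ) - 2 * (k : ℤ) - 1 - 2))) =
      halfPowSum m e ν - halfPowCoeff (m + 1) (m + 1) * (e ^ (m + 1) * ν ^ (-3 : ℤ)) := by
  have hexp (k : ℕ) : 2 * ((m + 1 : ℕ) : ℤ) - 2 * (k : ℤ) - 1 - 2 = 2 * (m : ℤ) - 2 * k - 1 := by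
    push_cast; ring
  have hlast : 2 * ((m + 1 : ℕ) : ℤ) - 2 * ((m + 1 : ℕ) : ℤ) - 1 = -1 := by ring
  rw [sum_range_succ, hlast, halfPowSum, sum_congr rfl fun k hk => by
    rw [← mul_assoc, halfPowCoeff_succ_mul (Nat.lt_succ_iff.1 (mem_range.1 hk)), hexp]]
  norm_num
  ring

lemma hasDerivAt_pow_mul_zpow {e ν : ℝ → ℝ} {e' q s : ℝ} (he : HasDerivAt e e' s)
    (hν : HasDerivAt ν (q / ν s) s) (h0 : ν s ≠ 0) (k : ℕ) (j : ℤ) :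
    HasDerivAt (fun s => e s ^ k * ν s ^ j)
      (e' * (k * e s ^ (k - 1) * ν s ^ j) + q * (j * (e s ^ k * ν s ^ (j - 2)))) s := by
  have hj : j - 1 = j - 2 + 1 := by ring
  refine ((he.pow k).mul ((hasDerivAt_zpow j (ν s) (Or.inl h0)).comp s hν)).congr_deriv ?_
  rw [hj, zpow_add_one₀ h0]
  simp only [Function.comp_apply, Pi.pow_apply]
  field_simp

/-- The two sums cancel up to the last term, since `ν ^ 2 - 2 * e` has the constant
derivative `2 * γ`. -/
lemma hasDerivAt_halfPowSum {m : ℕ} {e ν : ℝ → ℝ} {e' γ s : ℝ} (he : HasDerivAt e e' s)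
    (hν : HasDerivAt ν ((e' + γ) / ν s) s) (h0 : ν s ≠ 0) :
    HasDerivAt (fun s => halfPowSum (m + 1) (e s) (ν s))
      (γ * halfPowSum m (e s) (ν s) -
        (e' + γ) * (halfPowCoeff (m + 1) (m + 1) * (e s ^ (m + 1) * ν s ^ (-3 : ℤ)))) s := by
  refine (HasDerivAt.fun_sum fun k _ => (hasDerivAt_pow_mul_zpow he hν h0 k
    (2 * ((m + 1 : ℕ) : ℤ) - 2 * (k : ℤ) - 1)).const_mul (halfPowCoeff (m + 1) k)).congr_deriv ?_
  simp only [mul_add, sum_add_distrib, mul_left_comm _ e', mul_left_comm _ (e' + γ), ← mul_sum,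
    sum_halfPowCoeff_succ_mul_left, sum_halfPowCoeff_succ_mul_right]
  ring

lemma contDiffAt_halfPowSum {e ν : ℝ → ℝ} {s : ℝ} (he : ContDiffAt ℝ ω e s)
    (hν : ContDiffAt ℝ ω ν s) (h0 : ν s ≠ 0) (m : ℕ) :
    ContDiffAt ℝ ω (fun s => halfPowSum m (e s) (ν s)) s :=
  ContDiffAt.sum fun _ _ => contDiffAt_const.mul ((he.pow _).mul (contDiffAt_zpow hν h0 _))

end HalfIntegerPowers

section Line

variable {E : Type*} [NormedAddCommGroup E] [InnerProductSpace ℝ E] {x z : E}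

lemma hasDerivAt_norm_add_smul {s : ℝ} (h : z + s • x ≠ 0) :
    HasDerivAt (fun s : ℝ => ‖z + s • x‖) (inner ℝ x (z + s • x) / ‖z + s • x‖) s := by
  have hline : HasDerivAt (fun s : ℝ => z + s • x) x s := by
    simpa using ((hasDerivAt_id s).smul_const x).const_add z
  have hsqrt := hline.norm_sq.sqrt (pow_ne_zero 2 (norm_ne_zero_iff.2 h))
  simp only [Real.sqrt_sq (norm_nonneg _), real_inner_comm] at hsqrt
  exact hsqrt.congr_deriv (mul_div_mul_left _ _ two_ne_zero)

lemma contDiffAt_norm_add_smul (hz : z ≠ 0) : ContDiffAt ℝ ω (fun s : ℝ => ‖z + s • x‖) 0 :=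
  ContDiffAt.norm ℝ (by fun_prop) (by simpa using hz)

/-- With `e = d * s + ‖x‖ ^ 2 / 2 * s ^ 2` and `ν = ‖z + s • x‖`, the function `ν ^ 2 - 2 * e` is
affine in `s`, and the neglected terms of the expansion are divisible by `s ^ (m + 1)`. -/
lemma iteratedDeriv_halfPowSum (d : ℝ) (hz : z ≠ 0) (m : ℕ) :
    iteratedDeriv m (fun s => halfPowSum m (s * (d + ‖x‖ ^ 2 / 2 * s)) ‖z + s • x‖) 0 =
      (inner ℝ x z - d) ^ m * ‖z‖⁻¹ := by
  set γ := inner ℝ x z - d with hγ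
  set e : ℝ → ℝ := fun s => s * (d + ‖x‖ ^ 2 / 2 * s) with he_def
  have hν : ContDiffAt ℝ ω (fun s : ℝ => ‖z + s • x‖) 0 := contDiffAt_norm_add_smul hz
  have h0 : ‖z + (0 : ℝ) • x‖ ≠ 0 := by simpa using hz
  induction m with
  | zero => simp [halfPowSum, halfPowCoeff]
  | succ m ih =>
    set R : ℝ → ℝ := fun s => -(d + ‖x‖ ^ 2 * s + γ) * halfPowCoeff (m + 1) (m + 1) *
      (d + ‖x‖ ^ 2 / 2 * s) ^ (m + 1) * ‖z + s • x‖ ^ (-3 : ℤ) with hR_def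
    have hz3 := contDiffAt_zpow hν h0 (-3)
    have hR : ContDiffAt ℝ ω R 0 := by fun_prop
    have hS := contDiffAt_halfPowSum (e := e) (by fun_prop) hν h0 m
    have hmain : ContDiffAt ℝ ω (fun s => γ * halfPowSum m (e s) ‖z + s • x‖) 0 := by fun_prop
    have hrem : ContDiffAt ℝ ω (fun s => s ^ (m + 1) * R s) 0 := by fun_prop
    have hderiv : deriv (fun s => halfPowSum (m + 1) (e s) ‖z + s • x‖) =ᶠ[𝓝 0]
        fun s => γ * halfPowSum m (e s) ‖z + s • x‖ + s ^ (m + 1) * R s := by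
      filter_upwards [hν.continuousAt.eventually_ne h0] with s hs
      have he : HasDerivAt e (d + ‖x‖ ^ 2 * s) s :=
        ((hasDerivAt_id s).mul
          (((hasDerivAt_id s).const_mul (‖x‖ ^ 2 / 2)).const_add d)).congr_deriv
            (by simp only [id]; ring)
      have hinner : inner ℝ x (z + s • x) = d + ‖x‖ ^ 2 * s + γ := by
        rw [inner_add_right, real_inner_smul_right, real_inner_self_eq_norm_sq, hγ]
        ring
      have hνs := hasDerivAt_norm_add_smul (norm_ne_zero_iff.1 hs)
      rw [hinner] at hνs
      rw [(hasDerivAt_halfPowSum he hνs hs).deriv, he_def, hR_def]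
      simp only [mul_pow]
      ring
    rw [iteratedDeriv_succ', hderiv.iteratedDeriv_eq,
      iteratedDeriv_fun_add (hmain.of_le le_top) (hrem.of_le le_top),
      iteratedDeriv_const_mul_field, ih, iteratedDeriv_pow_mul_zero (hR.of_le le_top),
      Nat.descFactorial_succ, Nat.sub_self]
    push_cast
    ring

end Line

section NormPowers

lemma prod_range_sub_sub_one (k p : ℕ) :
    ∏ i ∈ range p, ((p : ℝ) - k - 1 - i) = (-1) ^ p * k.descFactorial p := by
  have hfac : ∀ i ∈ range p, ((p : ℝ) - k - 1 - (p - 1 - i : ℕ)) = -1 * (k - i) := fun i hi => by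
    have hip : i < p := mem_range.1 hi
    rw [Nat.cast_sub (by omega), Nat.cast_sub (by omega)]
    push_cast
    ring
  rw [← prod_range_reflect, prod_congr rfl hfac, prod_mul_distrib, prod_const, card_range,
    ← descPochhammer_eval_eq_prod_range, descPochhammer_eval_eq_descFactorial]

lemma iteratedDeriv_pow_mul_comp_add_smul {E : Type*} [NormedAddCommGroup E] [NormedSpace ℝ E]
    {φ : E → ℝ} {z : E} (hφ : ContDiffAt ℝ ω φ z) (x : E) (d f : ℝ) (m k : ℕ) :
    iteratedDeriv m (fun s : ℝ => (s * (d + f * s)) ^ k * φ (z + s • x)) 0 =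
      ∑ p ∈ range (k + 1), (k.choose p * f ^ p * d ^ (k - p) * m.descFactorial (k + p)) *
        iteratedFDeriv ℝ (m - (k + p)) φ z (fun _ => x) := by
  have hφ' : ContDiffAt ℝ ω φ (z + (0 : ℝ) • x) := by simpa using hφ
  have hline : ContDiffAt ℝ ω (fun s : ℝ => φ (z + s • x)) 0 := hφ'.comp 0 (by fun_prop)
  have hexpand : (fun s : ℝ => (s * (d + f * s)) ^ k * φ (z + s • x)) =
      fun s => ∑ p ∈ range (k + 1), (k.choose p * f ^ p * d ^ (k - p)) *
        (s ^ (k + p) * φ (z + s • x)) := by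
    ext s
    rw [mul_pow, add_comm d, add_pow, mul_sum, sum_mul]
    refine sum_congr rfl fun p _ => ?_
    rw [mul_pow, pow_add]
    ring
  rw [hexpand, iteratedDeriv_fun_sum fun p _ =>
    ContDiffAt.of_le (n := ω) (by fun_prop) le_top]
  refine sum_congr rfl fun p _ => ?_
  rw [iteratedDeriv_const_mul_field, iteratedDeriv_pow_mul_zero (hline.of_le le_top),
    iteratedDeriv_comp_add_smul hφ', zero_smul, add_zero, ← mul_assoc]

variable {E : Type*} [NormedAddCommGroup E] [InnerProductSpace ℝ E] {y z : E}

lemma contDiffAt_norm_zpow (hz : z ≠ 0) (j : ℤ) : ContDiffAt ℝ ω (fun z : E => ‖z‖ ^ j) z :=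
  contDiffAt_zpow (contDiffAt_norm ℝ hz) (norm_ne_zero_iff.2 hz) j

lemma sum_iteratedFDeriv_norm_zpow (hz : z ≠ 0) (x : E) (d : ℝ) (m : ℕ) :
    ∑ k ∈ range (m + 1), ∑ p ∈ range (k + 1),
      (halfPowCoeff m k * (k.choose p * (‖x‖ ^ 2 / 2) ^ p * d ^ (k - p) *
        m.descFactorial (k + p))) *
        iteratedFDeriv ℝ (m - (k + p)) (fun z : E => ‖z‖ ^ (2 * (m : ℤ) - 2 * (k : ℤ) - 1)) z
          (fun _ => x) =
      (inner ℝ x z - d) ^ m * ‖z‖⁻¹ := by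
  have hz' : z + (0 : ℝ) • x ≠ 0 := by simpa using hz
  have hterm (k : ℕ) (j : ℤ) : ContDiffAt ℝ ω
      (fun s : ℝ => (s * (d + ‖x‖ ^ 2 / 2 * s)) ^ k * ‖z + s • x‖ ^ j) 0 :=
    ContDiffAt.mul (by fun_prop)
      (contDiffAt_zpow (contDiffAt_norm_add_smul hz) (norm_ne_zero_iff.2 hz') j)
  simp only [← iteratedDeriv_halfPowSum d hz m, halfPowSum]
  rw [iteratedDeriv_fun_sum fun k _ => (contDiffAt_const.mul (hterm k _)).of_le le_top]
  refine sum_congr rfl fun k _ => ?_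
  rw [iteratedDeriv_const_mul_field,
    iteratedDeriv_pow_mul_comp_add_smul (contDiffAt_norm_zpow hz _), mul_sum]
  exact sum_congr rfl fun p _ => mul_assoc _ _ _

lemma sum_iteratedFDeriv_iteratedFDeriv_norm_zpow (hy : y ≠ 0) (x : E) {m : ℕ} (w : Fin m → E) :
    ∑ k ∈ range (m + 1), ∑ p ∈ range (k + 1),
      (halfPowCoeff m k * (k.choose p * (‖x‖ ^ 2 / 2) ^ p * inner ℝ x y ^ (k - p) *
        m.descFactorial (k + p))) *
        iteratedFDeriv ℝ (m - (k + p)) (fun z => iteratedFDeriv ℝ m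
          (fun z : E => ‖z‖ ^ (2 * (m : ℤ) - 2 * (k : ℤ) - 1)) z w) y (fun _ => x) =
      m.factorial * (∏ i, inner ℝ x (w i)) * ‖y‖⁻¹ := by
  have hφ (k : ℕ) := contDiffAt_norm_zpow hy (2 * (m : ℤ) - 2 * (k : ℤ) - 1)
  have hD (k p : ℕ) := contDiffAt_iteratedFDeriv_apply_const (hφ k)
    (fun _ : Fin (m - (k + p)) => x)
  have hexpand := (EventuallyEq.iteratedFDeriv ℝ (eventually_ne_nhds hy |>.mono fun z hz =>
    sum_iteratedFDeriv_norm_zpow hz x (inner ℝ x y) m) m).self_of_nhds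
  have hinv : ContDiffAt ℝ ω (fun z : E => ‖z‖⁻¹) y :=
    (contDiffAt_norm ℝ hy).inv (norm_ne_zero_iff.2 hy)
  have hlead := iteratedFDeriv_affine_pow_mul (innerSL ℝ x) hinv w
  simp only [innerSL_apply_apply] at hlead
  rw [← hlead, ← hexpand, iteratedFDeriv_fun_sum_apply fun k _ =>
    ContDiffAt.sum fun p _ => (contDiffAt_const.mul (hD k p)).of_le le_top, _root_.sum_apply]
  refine sum_congr rfl fun k _ => ?_
  rw [iteratedFDeriv_fun_sum_apply fun p _ => (contDiffAt_const.mul (hD k p)).of_le le_top,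
    _root_.sum_apply]
  refine sum_congr rfl fun p _ => ?_
  rw [iteratedFDeriv_iteratedFDeriv_comm (hφ k)]
  exact (DFunLike.congr_fun (iteratedFDeriv_const_smul_apply' (𝕜 := ℝ) (R := ℝ)
    ((hD k p).of_le le_top)) w).symm

lemma iteratedFDeriv_norm_zpow_append_self (hy : y ≠ 0) {m k p a : ℕ} (ha : k + p + a = m)
    (u : Fin a → E) (w : Fin m → E) :
    iteratedFDeriv ℝ (a + p) (fun z => iteratedFDeriv ℝ m
        (fun z : E => ‖z‖ ^ (2 * (m : ℤ) - 2 * (k : ℤ) - 1)) z w) y (Fin.append u fun _ => y) =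
      (-1) ^ p * k.descFactorial p * iteratedFDeriv ℝ a (fun z => iteratedFDeriv ℝ m
        (fun z : E => ‖z‖ ^ (2 * (m : ℤ) - 2 * (k : ℤ) - 1)) z w) y u := by
  have hφ := contDiffAt_iteratedFDeriv_apply_const
    (contDiffAt_norm_zpow hy (2 * (m : ℤ) - 2 * (k : ℤ) - 1)) w
  have hdeg : (2 * (m : ℤ) - 2 * (k : ℤ) - 1) - (m : ℕ) - (a : ℕ) = p - k - 1 := by omega
  have hhom := ((IsPosHomogeneous.norm_zpow (E := E) (2 * (m : ℤ) - 2 * (k : ℤ) - 1)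
    ).iteratedFDeriv_apply w).iteratedFDeriv_apply u
  rw [hdeg] at hhom
  rw [iteratedFDeriv_append hφ, iteratedFDeriv_iteratedFDeriv_comm hφ,
    hhom.iteratedFDeriv_self (contDiffAt_iteratedFDeriv_apply_const hφ u)]
  push_cast
  rw [prod_range_sub_sub_one]

lemma doubleFactorial_coeff_mul_descFactorial (m k p : ℕ) :
    ((-1) ^ k / ((2 * (m - k) - 1).doubleFactorial : ℝ) * m.choose k) *
        (((-1) ^ p / 2 ^ p * (m - k).choose p) * ((-1) ^ p * k.descFactorial p)) =
      halfPowCoeff m k * (k.choose p / 2 ^ p * m.descFactorial (k + p)) := by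
  have hdesc : m.descFactorial (k + p) =
      (p.factorial * (m - k).choose p) * (k.factorial * m.choose k) := by
    rw [← Nat.descFactorial_mul_descFactorial (Nat.le_add_right k p), Nat.add_sub_cancel_left,
      Nat.descFactorial_eq_factorial_mul_choose, Nat.descFactorial_eq_factorial_mul_choose]
  have hsign : ((-1 : ℝ) ^ p) ^ 2 = 1 := by rw [pow_right_comm, neg_one_sq, one_pow]
  have hdf : ((2 * (m - k) - 1).doubleFactorial : ℝ) ≠ 0 :=
    mod_cast (Nat.doubleFactorial_pos _).ne'
  rw [hdesc, Nat.descFactorial_eq_factorial_mul_choose, halfPowCoeff]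
  push_cast
  field_simp
  rw [hsign, mul_one]

lemma sum_contract_iteratedFDeriv_norm_zpow (hy : y ≠ 0) (x : E) {m : ℕ} (w : Fin m → E) :
    ‖y‖ / m.factorial * ∑ k ∈ range (m + 1),
      ((-1) ^ k / ((2 * (m - k) - 1).doubleFactorial : ℝ) * m.choose k) *
        ∑ p ∈ range (min k (m - k) + 1), ((-1) ^ p / 2 ^ p * (m - k).choose p) *
          ((‖x‖ ^ 2) ^ p * inner ℝ x y ^ (k - p) *
            iteratedFDeriv ℝ (m - k - p + p) (fun z => iteratedFDeriv ℝ m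
              (fun z : E => ‖z‖ ^ (2 * (m : ℤ) - 2 * (k : ℤ) - 1)) z w) y
              (Fin.append (fun _ => x) fun _ => y)) =
      ∏ i, inner ℝ x (w i) := by
  have hy0 : ‖y‖ ≠ 0 := norm_ne_zero_iff.2 hy
  have hm : (m.factorial : ℝ) ≠ 0 := by positivity
  suffices hsum : ∑ k ∈ range (m + 1), _ = m.factorial * (∏ i, inner ℝ x (w i)) * ‖y‖⁻¹ by
    rw [hsum]
    field_simp
  rw [← sum_iteratedFDeriv_iteratedFDeriv_norm_zpow hy x w]
  refine sum_congr rfl fun k hk => ?_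
  have hkm : k ≤ m := Nat.lt_succ_iff.1 (mem_range.1 hk)
  rw [mul_sum]
  refine sum_subset_zero_on_sdiff (range_subset_range.2 (by omega)) (fun p hp => ?_)
    fun p hp => ?_
  · have hp' : m < k + p := by
      simp only [Finset.mem_sdiff, mem_range] at hp
      omega
    rw [Nat.descFactorial_eq_zero_iff_lt.2 hp']
    simp
  · have hp' : k + p + (m - k - p) = m := by
      rw [mem_range] at hp
      omega
    rw [iteratedFDeriv_norm_zpow_append_self hy hp', Nat.sub_sub, div_pow]
    linear_combination (‖x‖ ^ 2) ^ p * inner ℝ x y ^ (k - p) *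
      iteratedFDeriv ℝ (m - (k + p)) (fun z => iteratedFDeriv ℝ m
        (fun z : E => ‖z‖ ^ (2 * (m : ℤ) - 2 * (k : ℤ) - 1)) z w) y (fun _ => x) *
      doubleFactorial_coeff_mul_descFactorial m k p

end NormPowers

section Append

variable {α : Type*}

lemma append_const_const (a b : ℕ) (x : α) :
    Fin.append (fun _ : Fin a => x) (fun _ : Fin b => x) = fun _ => x := by
  ext1 i
  refine Fin.addCases (fun i => ?_) (fun i => ?_) i <;> simp

lemma append_const_comp_cast {a b c : ℕ} (h : b = c) (u : Fin a → α) (y : α) :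
    Fin.append u (fun _ : Fin c => y) ∘ Fin.cast (congrArg (a + ·) h) =
      Fin.append u fun _ : Fin b => y := by
  subst h
  rfl

end Append

namespace Tensor

variable {n k r : ℕ}

/-- The multilinear form `(v₁, …, v_r) ↦ u_{i₁…i_r} v₁^{i₁} ⋯ v_r^{i_r}` of a tensor `u`, on real
vectors. -/
noncomputable def toForm : Tensor n r →ₗ[ℂ]
    ContinuousMultilinearMap ℝ (fun _ : Fin r => EuclideanSpace ℝ (Fin n)) ℂ :=
  Fintype.linearCombination ℂ fun i : Fin r → Fin n =>
    (ContinuousMultilinearMap.mkPiAlgebra ℝ (Fin r) ℂ).compContinuousLinearMap fun a =>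
      Complex.ofRealCLM ∘L EuclideanSpace.proj (i a)

lemma toForm_apply (u : Tensor n r) (v : Fin r → EuclideanSpace ℝ (Fin n)) :
    toForm u v = ∑ i, u i * ∏ a, (v a (i a) : ℂ) := by
  simp [toForm, Fintype.linearCombination_apply, _root_.sum_apply]

lemma toForm_append (t : Tensor n (k + r)) (v : Fin k → EuclideanSpace ℝ (Fin n))
    (w : Fin r → EuclideanSpace ℝ (Fin n)) :
    toForm t (Fin.append v w) = ∑ i : Fin k → Fin n, ∑ l : Fin r → Fin n,
      t (Fin.append i l) * ((∏ a, (v a (i a) : ℂ)) * ∏ a, (w a (l a) : ℂ)) := by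
  rw [toForm_apply, ← (Fin.appendEquiv k r).sum_comp, Fintype.sum_prod_type]
  simp [Fin.prod_univ_add, Fin.appendEquiv]

lemma toForm_single (u : Tensor n r) (l : Fin r → Fin n) :
    toForm u (fun a => EuclideanSpace.single (l a) (1 : ℝ)) = u l := by
  rw [toForm_apply, sum_eq_single l]
  · simp
  · intro i _ hi
    obtain ⟨a, ha⟩ := Function.ne_iff.1 hi
    rw [prod_eq_zero (mem_univ a) (by simp [ha]), mul_zero]
  · simp

lemma toForm_eq_sum_inner (u : Tensor n r) (x : EuclideanSpace ℝ (Fin n)) :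
    toForm u (fun _ => x) =
      ∑ l, u l * ((∏ a, inner ℝ x (EuclideanSpace.single (l a) (1 : ℝ)) : ℝ) : ℂ) := by
  simp [toForm_apply, EuclideanSpace.inner_single_right]

lemma toForm_cast {a b : ℕ} (h : a = b) (u : Tensor n a) (v : Fin b → EuclideanSpace ℝ (Fin n)) :
    toForm (cast h u) v = toForm u (v ∘ Fin.cast h) := by
  subst h
  rfl

lemma toForm_tmul (u : Tensor n k) (u' : Tensor n r) (v : Fin k → EuclideanSpace ℝ (Fin n))
    (w : Fin r → EuclideanSpace ℝ (Fin n)) :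
    toForm (tmul u u') (Fin.append v w) = toForm u v * toForm u' w := by
  rw [toForm_append, toForm_apply, toForm_apply, sum_mul_sum]
  refine sum_congr rfl fun i _ => sum_congr rfl fun l _ => ?_
  have hleft : Fin.append i l ∘ Fin.castAdd r = i := funext (Fin.append_left i l)
  have hright : Fin.append i l ∘ Fin.natAdd k = l := funext (Fin.append_right i l)
  rw [tmul, hleft, hright]
  ring

lemma toForm_symmetrize (u : Tensor n r) (x : EuclideanSpace ℝ (Fin n)) :
    toForm (symmetrize u) (fun _ => x) = toForm u (fun _ => x) := by
  have hperm (π : Equiv.Perm (Fin r)) :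
      ∑ i : Fin r → Fin n, u (i ∘ π) * ∏ a, (x (i a) : ℂ) = toForm u (fun _ => x) := by
    rw [toForm_apply]
    refine Fintype.sum_equiv (Equiv.arrowCongr π.symm (Equiv.refl (Fin n))) _ _ fun i => ?_
    exact congrArg (u (i ∘ π) * ·) (Equiv.prod_comp π fun a => (x (i a) : ℂ)).symm
  have hr : (r.factorial : ℂ) ≠ 0 := mod_cast r.factorial_ne_zero
  rw [toForm_apply]
  simp only [symmetrize, mul_assoc, sum_mul]
  rw [← mul_sum, sum_comm, sum_congr rfl fun π _ => hperm π, sum_const, card_univ,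
    Fintype.card_perm, Fintype.card_fin, nsmul_eq_mul, inv_mul_cancel_left₀ hr]

lemma toForm_iMulPow (u : Tensor n r) (p : ℕ) (v : Tensor n k) (x : EuclideanSpace ℝ (Fin n)) :
    toForm (iMulPow u p v) (fun _ => x) =
      toForm u (fun _ => x) ^ p * toForm v (fun _ => x) := by
  induction p with
  | zero => exact (one_mul _).symm
  | succ p ih =>
    calc toForm (iMulPow u (p + 1) v) (fun _ => x)
        = toForm (symmetrize (tmul (iMulPow u p v) u)) (fun _ => x) := toForm_cast _ _ _
      _ = toForm (iMulPow u p v) (fun _ => x) * toForm u (fun _ => x) := by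
        rw [toForm_symmetrize, ← toForm_tmul, append_const_const]
      _ = _ := by rw [ih, pow_succ]; ring

lemma toForm_ofVec (x y : EuclideanSpace ℝ (Fin n)) :
    toForm (ofVec y) (fun _ => x) = (inner ℝ x y : ℝ) := by
  rw [toForm_apply, ← (Equiv.funUnique (Fin 1) (Fin n)).symm.sum_comp]
  simp [ofVec, PiLp.inner_apply]

lemma toForm_kronecker (x : EuclideanSpace ℝ (Fin n)) :
    toForm (kronecker n) (fun _ => x) = ((‖x‖ ^ 2 : ℝ) : ℂ) := by
  rw [toForm_apply, ← (finTwoArrowEquiv (Fin n)).symm.sum_comp, Fintype.sum_prod_type,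
    EuclideanSpace.real_norm_sq_eq]
  simp [kronecker, sq]

lemma toForm_jContr (u : Tensor n r) (t : Tensor n (k + r))
    (v : Fin k → EuclideanSpace ℝ (Fin n)) :
    toForm (jContr u t) v =
      ∑ l, u l * toForm t (Fin.append v fun a => EuclideanSpace.single (l a) (1 : ℝ)) := by
  have hsingle (l : Fin r → Fin n) :
      toForm t (Fin.append v fun a => EuclideanSpace.single (l a) (1 : ℝ)) =
        ∑ i, t (Fin.append i l) * ∏ a, (v a (i a) : ℂ) := by
    rw [toForm_append, sum_comm, ← toForm_single (fun l => ∑ i, t (Fin.append i l) *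
      ∏ a, (v a (i a) : ℂ)) l, toForm_apply]
    simp only [sum_mul, mul_assoc]
  simp only [toForm_apply (jContr u t), hsingle, jContr, mul_sum, sum_mul]
  rw [sum_comm]
  exact sum_congr rfl fun l _ => sum_congr rfl fun i _ => by ring

lemma toForm_jContr_ofVec (y : EuclideanSpace ℝ (Fin n)) (t : Tensor n (k + 1))
    (v : Fin k → EuclideanSpace ℝ (Fin n)) :
    toForm (jContr (ofVec y) t) v = toForm t (Fin.append v fun _ => y) := by
  rw [toForm_append, toForm_apply]
  simp only [jContr, sum_mul, ofVec, Fin.prod_univ_one]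
  exact sum_congr rfl fun i _ => sum_congr rfl fun l _ => by ring

lemma toForm_jContrPow_ofVec (y : EuclideanSpace ℝ (Fin n)) (p : ℕ) (t : Tensor n (k + 1 * p))
    (v : Fin k → EuclideanSpace ℝ (Fin n)) :
    toForm (jContrPow (ofVec y) p t) v = toForm t (Fin.append v fun _ => y) := by
  induction p with
  | zero => exact congrArg (toForm t) (funext fun a => (Fin.append_left v _ a).symm)
  | succ p ih =>
    rw [jContrPow, ih, toForm_jContr_ofVec, toForm_cast, Fin.append_assoc, append_const_const]
    rfl

lemma toForm_fieldA (m k : ℕ) (y : EuclideanSpace ℝ (Fin n))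
    (v : Fin (2 * m - k) → EuclideanSpace ℝ (Fin n)) :
    toForm (fieldA n m k y) v =
      ((iteratedFDeriv ℝ (2 * m - k) (fun x : EuclideanSpace ℝ (Fin n) =>
        ‖x‖ ^ (2 * (m : ℤ) - 2 * (k : ℤ) - 1)) y v : ℝ) : ℂ) := by
  have hv : v = fun a => ∑ j, v a j • EuclideanSpace.single j (1 : ℝ) := by
    ext a j
    simp [Finset.sum_apply, Pi.single_apply]
  conv_rhs => rw [hv, ContinuousMultilinearMap.map_sum]
  simp only [ContinuousMultilinearMap.map_smul_univ, toForm_apply, fieldA, smul_eq_mul]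
  push_cast
  exact sum_congr rfl fun i _ => mul_comm _ _

lemma iteratedFDeriv_toForm_diagonal {u : Tensor n r} (hu : u ∈ symm n r) (l : Fin r → Fin n) :
    iteratedFDeriv ℝ r (fun x => toForm u fun _ => x) 0
      (fun a => EuclideanSpace.single (l a) (1 : ℝ)) = r.factorial * u l := by
  have hperm (σ : Equiv.Perm (Fin r)) :
      toForm u (fun a => EuclideanSpace.single (l (σ a)) (1 : ℝ)) = u l :=
    (toForm_single u (l ∘ σ)).trans (hu σ l)
  simp [ContinuousMultilinearMap.iteratedFDeriv_comp_diagonal, hperm, Fintype.card_perm]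

lemma eq_of_toForm_diagonal {u v : Tensor n r} (hu : u ∈ symm n r) (hv : v ∈ symm n r)
    (h : ∀ x, toForm u (fun _ => x) = toForm v (fun _ => x)) : u = v := by
  ext1 l
  have hr : (r.factorial : ℂ) ≠ 0 := mod_cast r.factorial_ne_zero
  refine mul_left_cancel₀ hr ?_
  rw [← iteratedFDeriv_toForm_diagonal hu, ← iteratedFDeriv_toForm_diagonal hv, funext h]

lemma cast_mem_symm {a b : ℕ} (h : a = b) {u : Tensor n a} (hu : u ∈ symm n a) :
    cast h u ∈ symm n b := by
  subst h
  exact hu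

lemma symmetrize_mem_symm (u : Tensor n r) : symmetrize u ∈ symm n r := fun π i =>
  congrArg ((r.factorial : ℂ)⁻¹ * ·)
    (Equiv.sum_comp (Equiv.mulLeft π) fun τ : Equiv.Perm (Fin r) => u (i ∘ τ))

lemma iMulPow_mem_symm (u : Tensor n r) (p : ℕ) {v : Tensor n k} (h : p = 0 → v ∈ symm n k) :
    iMulPow u p v ∈ symm n (k + r * p) := by
  cases p with
  | zero => exact h rfl
  | succ p => exact cast_mem_symm _ (symmetrize_mem_symm _)

variable {m : ℕ} {y : EuclideanSpace ℝ (Fin n)}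

lemma toForm_jContr_fieldA {k : ℕ} (hy : y ≠ 0) (g : Tensor n m) (h : 2 * m - k = m - k + m)
    (v : Fin (m - k) → EuclideanSpace ℝ (Fin n)) :
    toForm (jContr g (cast h (fieldA n m k y))) v =
      ∑ l, g l * ((iteratedFDeriv ℝ (m - k) (fun z => iteratedFDeriv ℝ m
        (fun z : EuclideanSpace ℝ (Fin n) => ‖z‖ ^ (2 * (m : ℤ) - 2 * (k : ℤ) - 1)) z
          fun a => EuclideanSpace.single (l a) 1) y v : ℝ) : ℂ) := by
  have hφ := contDiffAt_norm_zpow hy (2 * (m : ℤ) - 2 * (k : ℤ) - 1)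
  rw [toForm_jContr]
  refine sum_congr rfl fun l _ => ?_
  rw [toForm_cast, toForm_fieldA, ← iteratedFDeriv_append hφ]
  exact congrArg (g l * Complex.ofReal ·) (iteratedFDeriv_comp_finEquiv hφ (finCongr h) _)

lemma jContr_fieldA_mem_symm {k : ℕ} (hy : y ≠ 0) (g : Tensor n m) (h : 2 * m - k = m - k + m) :
    jContr g (cast h (fieldA n m k y)) ∈ symm n (m - k) := by
  intro π i
  rw [← toForm_single (jContr _ _) (i ∘ π), ← toForm_single (jContr _ _) i,
    toForm_jContr_fieldA hy, toForm_jContr_fieldA hy]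
  refine sum_congr rfl fun l _ => ?_
  exact congrArg (g l * Complex.ofReal ·) (iteratedFDeriv_comp_finEquiv
    (contDiffAt_iteratedFDeriv_apply_const (contDiffAt_norm_zpow hy _) _) π
      fun a => EuclideanSpace.single (i a) (1 : ℝ))

/-- The operator `i^p i_y^q j_y^p` from rank `l` to rank `m`. -/
noncomputable def mulContr {l m : ℕ} (y : EuclideanSpace ℝ (Fin n)) (p q : ℕ) {a : ℕ}
    (hl : l = a + 1 * p) (hm : a + 1 * q + 2 * p = m) (t : Tensor n l) : Tensor n m :=
  cast hm (iMulPow (kronecker n) p (iMulPow (ofVec y) q (jContrPow (ofVec y) p (cast hl t))))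

lemma toForm_mulContr {l p q a : ℕ} (hl : l = a + 1 * p) (hm : a + 1 * q + 2 * p = m)
    (t : Tensor n l) (x : EuclideanSpace ℝ (Fin n)) :
    toForm (mulContr y p q hl hm t) (fun _ => x) =
      (((‖x‖ ^ 2) ^ p * inner ℝ x y ^ q : ℝ) : ℂ) *
        toForm t (Fin.append (fun _ : Fin a => x) (fun _ : Fin p => y) ∘
          Fin.cast (hl.trans (congrArg (a + ·) (one_mul p)))) := by
  rw [mulContr, toForm_cast]
  calc toForm (iMulPow (kronecker n) p (iMulPow (ofVec y) q (jContrPow (ofVec y) p (cast hl t))))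
        (fun _ => x)
      = toForm (kronecker n) (fun _ => x) ^ p * (toForm (ofVec y) (fun _ => x) ^ q *
          toForm (jContrPow (ofVec y) p (cast hl t)) fun _ => x) := by
        rw [toForm_iMulPow, toForm_iMulPow]
    _ = _ := by
        rw [toForm_kronecker, toForm_ofVec, toForm_jContrPow_ofVec, toForm_cast,
          ← append_const_comp_cast (one_mul p)]
        push_cast
        rw [mul_assoc]
        rfl

lemma mulContr_mem_symm {l p q a : ℕ} (hl : l = a + 1 * p) (hm : a + 1 * q + 2 * p = m)
    {t : Tensor n l} (ht : t ∈ symm n l) : mulContr y p q hl hm t ∈ symm n m := by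
  refine cast_mem_symm _ (iMulPow_mem_symm _ _ fun hp => iMulPow_mem_symm _ _ fun _ => ?_)
  subst hp
  exact cast_mem_symm _ ht

lemma eq_sub_add_one_mul {l p : ℕ} (h : p ≤ l) : l = l - p + 1 * p := by omega

lemma sub_sub_add_one_mul_add_two_mul {m k p : ℕ} (hk : k ≤ m) (hp : p ≤ min k (m - k)) :
    m - k - p + 1 * (k - p) + 2 * p = m := by
  omega

/-- The right-hand side of the inversion formula at the point `y`, as a function of the values
`h k = H^{(m,k)}(y)`. -/
noncomputable def reconstruct (y : EuclideanSpace ℝ (Fin n))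
    (h : ∀ k : Fin (m + 1), Tensor n (m - k)) : Tensor n m :=
  ((‖y‖ : ℂ) / (m.factorial : ℂ)) • ∑ k : Fin (m + 1),
    ((-1 : ℂ) ^ (k : ℕ) / ((2 * (m - k) - 1).doubleFactorial : ℂ) * (m.choose k : ℂ)) •
      ∑ p : Fin (min (k : ℕ) (m - k) + 1),
        ((-1 : ℂ) ^ (p : ℕ) / 2 ^ (p : ℕ) * ((m - k).choose p : ℂ)) •
          mulContr y p (k - p) (eq_sub_add_one_mul (p.is_le.trans (min_le_right _ _)))
            (sub_sub_add_one_mul_add_two_mul k.is_le p.is_le) (h k)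

lemma reconstruct_mem_symm {h : ∀ k : Fin (m + 1), Tensor n (m - k)}
    (hh : ∀ k : Fin (m + 1), h k ∈ symm n (m - k)) : reconstruct y h ∈ symm n m :=
  Submodule.smul_mem _ _ <| Submodule.sum_mem _ fun k _ => Submodule.smul_mem _ _ <|
    Submodule.sum_mem _ fun _ _ => Submodule.smul_mem _ _ (mulContr_mem_symm _ _ (hh k))

lemma toForm_mulContr_jContr_fieldA {k p q : ℕ} (hy : y ≠ 0) (g : Tensor n m)
    (h : 2 * m - k = m - k + m) (hl : m - k = m - k - p + 1 * p)
    (hm : m - k - p + 1 * q + 2 * p = m) (x : EuclideanSpace ℝ (Fin n)) :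
    toForm (mulContr y p q hl hm (jContr g (cast h (fieldA n m k y)))) (fun _ => x) =
      ∑ l, g l * (((‖x‖ ^ 2) ^ p * inner ℝ x y ^ q *
        iteratedFDeriv ℝ (m - k - p + p) (fun z => iteratedFDeriv ℝ m
          (fun z : EuclideanSpace ℝ (Fin n) => ‖z‖ ^ (2 * (m : ℤ) - 2 * (k : ℤ) - 1)) z
            fun a => EuclideanSpace.single (l a) 1) y (Fin.append (fun _ => x) fun _ => y) : ℝ) :
        ℂ) := by
  rw [toForm_mulContr, toForm_jContr_fieldA hy, mul_sum]
  refine sum_congr rfl fun l _ => ?_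
  have hrank : iteratedFDeriv ℝ (m - k) _ y _ = iteratedFDeriv ℝ (m - k - p + p) _ y _ :=
    iteratedFDeriv_comp_finEquiv (contDiffAt_iteratedFDeriv_apply_const
      (contDiffAt_norm_zpow hy (2 * (m : ℤ) - 2 * (k : ℤ) - 1))
        (fun a => EuclideanSpace.single (l a) (1 : ℝ))) (finCongr (by omega))
      (Fin.append (fun _ => x) fun _ => y)
  rw [← hrank, mul_left_comm, ← Complex.ofReal_mul]
  rfl

lemma toForm_reconstruct (hy : y ≠ 0) (g : Tensor n m) (x : EuclideanSpace ℝ (Fin n)) :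
    toForm (reconstruct y fun k : Fin (m + 1) =>
        jContr g (cast (by omega) (fieldA n m k y))) (fun _ => x) = toForm g fun _ => x := by
  simp only [reconstruct, map_smul, map_sum, _root_.smul_apply, _root_.sum_apply, smul_eq_mul,
    toForm_mulContr_jContr_fieldA hy, toForm_eq_sum_inner g,
    ← sum_contract_iteratedFDeriv_norm_zpow hy x, Finset.sum_range, Complex.ofReal_mul,
    Complex.ofReal_sum, mul_sum]
  rw [sum_comm]
  refine sum_congr rfl fun k _ => ?_
  rw [sum_comm]
  refine sum_congr rfl fun p _ => sum_congr rfl fun l _ => ?_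
  push_cast
  ring

lemma reconstruct_jContr_fieldA (hy : y ≠ 0) {g : Tensor n m} (hg : g ∈ symm n m) :
    reconstruct y (fun k : Fin (m + 1) => jContr g (cast (by omega) (fieldA n m k y))) = g :=
  eq_of_toForm_diagonal (reconstruct_mem_symm fun _ => jContr_fieldA_mem_symm hy g _) hg
    (toForm_reconstruct hy g)

end Tensor

lemma IsSystemSolution.eq_reconstruct {n m : ℕ}
    {H : (k : Fin (m + 1)) → PuncturedSpace n → Tensor.symm n (m - k)}
    {g : PuncturedSpace n → Tensor.symm n m} (hg : IsSystemSolution H g) (y : PuncturedSpace n) :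
    (g y : Tensor n m) = Tensor.reconstruct y fun k => H k y := by
  rw [← Tensor.reconstruct_jContr_fieldA y.2 (g y).2, funext fun k => hg k y]

theorem proposition6p1 (n m : ℕ)
    (H : (k : Fin (m + 1)) → PuncturedSpace n → Tensor.symm n (m - k))
    (hsol : ∃ g : PuncturedSpace n → Tensor.symm n m, IsSystemSolution H g) :
    (∃! g : PuncturedSpace n → Tensor.symm n m, IsSystemSolution H g) ∧
    ∀ g : PuncturedSpace n → Tensor.symm n m, IsSystemSolution H g →
      ∀ y : PuncturedSpace n,
        (g y : Tensor n m) =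
          ((‖(y : EuclideanSpace ℝ (Fin n))‖ : ℂ) / (m.factorial : ℂ)) •
            ∑ k : Fin (m + 1),
              ((-1 : ℂ) ^ (k : ℕ) / (Nat.doubleFactorial (2 * (m - k) - 1) : ℂ) *
                  (m.choose k : ℂ)) •
                ∑ p : Fin (min (k : ℕ) (m - k) + 1),
                  ((-1 : ℂ) ^ (p : ℕ) / 2 ^ (p : ℕ) * ((m - k).choose p : ℂ)) •
                    Tensor.cast (by omega : (m - k - p) + 1 * (k - p) + 2 * p = m)
                      (Tensor.iMulPow (Tensor.kronecker n) p
                        (Tensor.iMulPow (Tensor.ofVec y) (k - p)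
                          (Tensor.jContrPow (Tensor.ofVec y) p
                            (Tensor.cast (by omega : m - (k : ℕ) = (m - k - p) + 1 * p)
                              (H k y : Tensor n (m - k)))))) := by
  obtain ⟨g, hg⟩ := hsol
  refine ⟨⟨g, hg, fun g' hg' => ?_⟩, fun g hg y => hg.eq_reconstruct y⟩
  exact funext fun y => Subtype.ext ((hg'.eq_reconstruct y).trans (hg.eq_reconstruct y).symm)
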